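/- Let $\mathcal C$ be a regular category, i.e. a category with finite limits in which every kernel pair has a coequalizer and regular epimorphisms are stable under pullback. A relation from $X$ to $Y$ is a subobject of $X\times Y$; relations are composed by taking the pullback of the adjacent legs and then the regular image. An equivalence relation is effective if it is the kernel pair of some morphism. A category $\mathcal C$ as above is a Goursat category if $RSR=SRS$ for all equivalence relations $R,S$ on a same object of $\mathcal C$. Consider morphisms $f\colon X\to Y$, $l\colon Z\to Y$, $g\colon U\to W$, $h\colon V\to W$ with given splittings $i,k,j,m$ (so $fi=1_Y$, $lk=1_Y$, $gj=1_W$, $hm=1_W$), and regular epimorphisms $\alpha\colon X\to U$, $\beta\colon Y\to W$, $\gamma\colon Z\to V$ with $$g\alpha=\beta f,\qquad \alpha i=j\beta,\qquad h\gamma=\beta l,\qquad \gamma k=m\beta. \tag{$*$}$$ Let $X\times_Y Z$ be the pullback of $f$ and $l$, with projections $\pi_X,\pi_Z$, split by $\langle 1_X,kf\rangle$ and $\langle il,1_Z\rangle$ respectively. **Theorem.** For a regular category $\mathcal C$ the following conditions are equivalent. (i) $\mathcal C$ is a Goursat category. (i′) $RSR=SRS$ for all effective equivalence relations $R,S$ on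 a same object of $\mathcal C$. (ii) For all data $(*)$, the comparison morphism $\lambda\colon X\times_Y Z\to U\times_W V$ between the pullback of $f,l$ and the pullback of $g,h$, induced by $\alpha$ and $\gamma$, is a regular epimorphism. (iii) For all data $(*)$, every object $A$ with morphisms $a\colon A\to U$, $b\colon A\to V$ and splittings $s$ of $a$ and $t$ of $b$ (so $as=1_U$, $bt=1_V$) such that $ga=hb$ and $sj=tm$, and every regular epimorphism $\delta\colon X\times_Y Z\to A$ with $$a\delta=\alpha\pi_X,\qquad b\delta=\gamma\pi_Z,\qquad \delta\langle 1_X,kf\rangle=s\alpha,\qquad \delta\langle il,1_Z\rangle=t\gamma,$$ the square $ga=hb$ is a pullback. -/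

import Mathlib

open CategoryTheory CategoryTheory.Limits

universe v u

namespace GoursatCube

section Relations

variable {C : Type u} [Category.{v} C] [Regular C]

/-- A relation from `X` to `Y`: a subobject of `X ⨯ Y`. Equality of relations is equality of
subobjects. -/
abbrev Relation (X Y : C) := Subobject (X ⨯ Y)

namespace Relation

/-- First leg `r₁ : R ⟶ X` of a relation `R` from `X` to `Y`. -/
noncomputable abbrev fst {X Y : C} (R : Relation X Y) : (R : C) ⟶ X := R.arrow ≫ prod.fst

/-- Second leg `r₂ : R ⟶ Y` of a relation `R` from `X` to `Y`. -/
noncomputable abbrev snd {X Y : C} (R : Relation X Y) : (R : C) ⟶ Y := R.arrow ≫ prod.snd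

/-- Composite of a relation `R` from `X` to `Y` with a relation `S` from `Y` to `Z` ("first `R`,
then `S`"): the regular image in `X ⨯ Z` of the pullback of `r₂` and `s₁`. -/
noncomputable def comp {X Y Z : C} (R : Relation X Y) (S : Relation Y Z) : Relation X Z :=
  imageSubobject
    (prod.lift (pullback.fst R.snd S.fst ≫ R.fst) (pullback.snd R.snd S.fst ≫ S.snd))

/-- `R` is an (internal) equivalence relation: reflexive, symmetric and transitive. -/
def IsEquivalence {X : C} (R : Relation X X) : Prop :=
  IsEquivalenceRelation R.fst R.snd

/-- `R` is an effective equivalence relation: its legs are the kernel pair of some morphism. -/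
def IsEffective {X : C} (R : Relation X X) : Prop :=
  ∃ (Y : C) (f : X ⟶ Y), IsKernelPair f R.fst R.snd

end Relation

end Relations

section Conditions

variable (C : Type u) [Category.{v} C]

/-- Goursat category: the composition of equivalence relations is 3-permutable, `RSR = SRS`, for
all equivalence relations `R` and `S` on a same object. -/
def IsGoursat [Regular C] : Prop :=
  ∀ (X : C) (R S : Relation X X), R.IsEquivalence → S.IsEquivalence →
    (R.comp S).comp R = (S.comp R).comp S

/-- 3-permutability, `RSR = SRS`, for all effective equivalence relations `R` and `S` on a same
object. -/
def IsEffectivelyGoursat [Regular C] : Prop :=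
  ∀ (X : C) (R S : Relation X X), R.IsEffective → S.IsEffective →
    (R.comp S).comp R = (S.comp R).comp S

/-- The front and bottom faces of the cube: four points (split epimorphisms with a given splitting)
`(f, i)`, `(l, k)` over `Y` and `(g, j)`, `(h, m)` over `W`, and regular epimorphisms `α, β, γ`
such that `(α, β)` and `(γ, β)` commute both with the split epimorphisms and with the splittings:
```
      α                   γ
  X -----> U          Z -----> V
 f| ↑i    g| ↑j      l| ↑k    h| ↑m
  ↓ |      ↓ |        ↓ |      ↓ |
  Y -----> W          Y -----> W
      β                   β
```
-/
structure CubeBase where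
  {X Y Z U V W : C}
  f : X ⟶ Y
  i : Y ⟶ X
  l : Z ⟶ Y
  k : Y ⟶ Z
  g : U ⟶ W
  j : W ⟶ U
  h : V ⟶ W
  m : W ⟶ V
  α : X ⟶ U
  β : Y ⟶ W
  γ : Z ⟶ V
  i_f : i ≫ f = 𝟙 Y
  k_l : k ≫ l = 𝟙 Y
  j_g : j ≫ g = 𝟙 W
  m_h : m ≫ h = 𝟙 W
  f_β : f ≫ β = α ≫ g
  i_α : i ≫ α = β ≫ j
  l_β : l ≫ β = γ ≫ h
  k_γ : k ≫ γ = β ≫ m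
  regularEpi_α : IsRegularEpi α
  regularEpi_β : IsRegularEpi β
  regularEpi_γ : IsRegularEpi γ

variable {C} in
/-- The canonical splitting `⟨1_X, kf⟩ : X ⟶ X ×_Y Z` of the projection `π_X`. -/
noncomputable def CubeBase.secX (K : CubeBase C) {P : C} {πX : P ⟶ K.X} {πZ : P ⟶ K.Z}
    (left : IsPullback πX πZ K.f K.l) : K.X ⟶ P :=
  left.lift (𝟙 K.X) (K.f ≫ K.k) (by rw [Category.id_comp, Category.assoc, K.k_l, Category.comp_id])

variable {C} in
/-- The canonical splitting `⟨il, 1_Z⟩ : Z ⟶ X ×_Y Z` of the projection `π_Z`. -/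
noncomputable def CubeBase.secZ (K : CubeBase C) {P : C} {πX : P ⟶ K.X} {πZ : P ⟶ K.Z}
    (left : IsPullback πX πZ K.f K.l) : K.Z ⟶ P :=
  left.lift (K.l ≫ K.i) (𝟙 K.Z) (by rw [Category.id_comp, Category.assoc, K.i_f, Category.comp_id])

/-- For every cube whose left face `P = X ×_Y Z` and right face `Q = U ×_W V` are pullbacks of
split epimorphisms, the comparison morphism `c : P ⟶ Q` is a regular epimorphism. (`c` is the
unique morphism making the cube commute; that it commutes with the canonical splittings of the
pullback projections is automatic.) -/
def ComparisonIsRegularEpi : Prop :=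
  ∀ (K : CubeBase C) ⦃P Q : C⦄ (πX : P ⟶ K.X) (πZ : P ⟶ K.Z) (πU : Q ⟶ K.U) (πV : Q ⟶ K.V)
    (c : P ⟶ Q), IsPullback πX πZ K.f K.l → IsPullback πU πV K.g K.h →
    c ≫ πU = πX ≫ K.α → c ≫ πV = πZ ≫ K.γ →
    IsRegularEpi c

variable {C} in
/-- A commutative cube over the base `K` whose left face is the pullback `P = X ×_Y Z` with its
canonical splittings, whose right face is a commutative diagram of split epimorphisms
```
       b
    A ----> V
  a |       | h
    ↓       ↓
    U ----> W
       g
```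
(with `s, t, j, m` splitting `a, b, g, h`, also commuting in the splitting direction),
and whose fourth horizontal morphism `δ` is a regular epimorphism commuting with the projections
and with the splittings. (The remaining equations `s ≫ b = g ≫ m` and `t ≫ a = h ≫ j` follow from
those listed, since `α` and `γ` are epimorphisms.) -/
structure GeneralCube (K : CubeBase C) where
  {P A : C}
  πX : P ⟶ K.X
  πZ : P ⟶ K.Z
  left : IsPullback πX πZ K.f K.l
  a : A ⟶ K.U
  s : K.U ⟶ A
  b : A ⟶ K.V
  t : K.V ⟶ A
  s_a : s ≫ a = 𝟙 K.U
  t_b : t ≫ b = 𝟙 K.V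
  a_g : a ≫ K.g = b ≫ K.h
  j_s : K.j ≫ s = K.m ≫ t
  δ : P ⟶ A
  δ_a : δ ≫ a = πX ≫ K.α
  δ_b : δ ≫ b = πZ ≫ K.γ
  sec_δ_s : K.secX left ≫ δ = K.α ≫ s
  sec_δ_t : K.secZ left ≫ δ = K.γ ≫ t
  regularEpi_δ : IsRegularEpi δ

/-- In every cube as in `GeneralCube`, the right face is a pullback. -/
def RightFaceIsPullback : Prop :=
  ∀ (K : CubeBase C) (D : GeneralCube K), IsPullback D.a D.b K.g K.h

end Conditions

end GoursatCube

/-!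
The proof argues with generalized elements: a morphism `T ⟶ X` is treated as an element of `X`, and
an existence statement is only required to hold after restriction along a regular epimorphism
`T' ⟶ T` (a *cover*). In a regular category a composite of relations then consists of the pairs that
locally have an intermediate element (`Relation.mem_comp_iff`), and regular epimorphisms are the
locally surjective morphisms (`isRegularEpi_of_exists_cover_lift`).

Every condition is compared with `KernelPairsThreePermute`, the elementwise form of
`Eq(f) Eq(g) Eq(f) ≤ Eq(g) Eq(f) Eq(g)` for morphisms `f` and `g` with the same domain.

* It gives `RSR = SRS` for arbitrary equivalence relations: on the object of triples `x R y S z`,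
  take the kernel pairs of the two projections to `x` and to `z`.
* It gives surjectivity of the comparison `λ : X ×_Y Z ⟶ U ×_W V`. For `(u, v)`, choose `x` and `z`
  above `u` and `v`; the points `(x, kfx)`, `(ifx, kfx)`, `(ilz, klz)`, `(ilz, z)` are related
  alternately by the kernel pairs of `X ×_Y Z ⟶ Y`, of `λ`, and of `X ×_Y Z ⟶ Y` again. After
  permuting, the intermediate points supply one component each of a point above `(u, v)`.
* It gives the modular-type *shifting* property of kernel pairs, which, applied twice, shows that
  `Eq(λ) ≤ Eq(δ)` in a cube with regular epimorphism `δ`. As `λ` is a regular epimorphism, this makes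
  the right face a pullback.
* Conversely, if right faces are always pullbacks, then applying this to the regular image of `λ`
  shows that `λ` is a regular epimorphism. If this holds in all cubes, apply it to the cube
  obtained from `Eq(f)` and its direct image along the regular epimorphism part of `g`: lifting a
  pair of elements of this image with the same first component gives the required permutation.
-/

namespace GoursatCube

-- The computation rules of chosen products and pullbacks, which are not global simp lemmas.
attribute [local simp] prod.lift_fst prod.lift_snd prod.lift_fst_assoc prod.lift_snd_assoc
  pullback.lift_fst pullback.lift_snd pullback.lift_fst_assoc pullback.lift_snd_assoc

/-! ### Canonical splittings -/

section CanonicalSplittings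

variable {C : Type u} [Category.{v} C]

lemma CubeBase.secX_fst (K : CubeBase C) {P : C} {πX : P ⟶ K.X} {πZ : P ⟶ K.Z}
    (left : IsPullback πX πZ K.f K.l) : K.secX left ≫ πX = 𝟙 _ := left.lift_fst _ _ _

lemma CubeBase.secX_snd (K : CubeBase C) {P : C} {πX : P ⟶ K.X} {πZ : P ⟶ K.Z}
    (left : IsPullback πX πZ K.f K.l) : K.secX left ≫ πZ = K.f ≫ K.k := left.lift_snd _ _ _

lemma CubeBase.secZ_fst (K : CubeBase C) {P : C} {πX : P ⟶ K.X} {πZ : P ⟶ K.Z}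
    (left : IsPullback πX πZ K.f K.l) : K.secZ left ≫ πX = K.l ≫ K.i := left.lift_fst _ _ _

lemma CubeBase.secZ_snd (K : CubeBase C) {P : C} {πX : P ⟶ K.X} {πZ : P ⟶ K.Z}
    (left : IsPullback πX πZ K.f K.l) : K.secZ left ≫ πZ = 𝟙 _ := left.lift_snd _ _ _

end CanonicalSplittings

/-! ### Regular epimorphisms and covers -/

section

variable {C : Type u} [Category.{v} C] [Regular C]

lemma isRegularEpi_comp {X Y Z : C} (f : X ⟶ Y) (g : Y ⟶ Z) [IsRegularEpi f] [IsRegularEpi g] :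
    IsRegularEpi (f ≫ g) :=
  have := strongEpi_comp f g
  inferInstance

lemma isRegularEpi_of_isRegularEpi_comp {X Y Z : C} (f : X ⟶ Y) (g : Y ⟶ Z)
    [IsRegularEpi (f ≫ g)] : IsRegularEpi g :=
  have := strongEpi_of_strongEpi f g
  inferInstance

lemma exists_cover_lift {X Y T : C} (f : X ⟶ Y) [IsRegularEpi f] (y : T ⟶ Y) :
    ∃ (T' : C) (e : T' ⟶ T) (x : T' ⟶ X), IsRegularEpi e ∧ x ≫ f = e ≫ y :=
  ⟨_, pullback.snd f y, pullback.fst f y, inferInstance, pullback.condition⟩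

lemma isRegularEpi_of_exists_cover_lift {X Y : C} (f : X ⟶ Y)
    (H : ∀ ⦃T : C⦄ (y : T ⟶ Y), ∃ (T' : C) (e : T' ⟶ T) (x : T' ⟶ X),
      IsRegularEpi e ∧ x ≫ f = e ≫ y) : IsRegularEpi f := by
  obtain ⟨T', e, x, he, hx⟩ := H (𝟙 Y)
  rw [Category.comp_id] at hx
  rw [← hx] at he
  exact isRegularEpi_of_isRegularEpi_comp x f

/-! ### Generalized elements of relations -/

namespace Relation

/-- The `T`-elements `x` of `X` and `y` of `Y` are related by `R`: the pair `(x, y)` factors through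
the subobject `R` of `X ⨯ Y`. -/
def Mem {X Y T : C} (R : Relation X Y) (x : T ⟶ X) (y : T ⟶ Y) : Prop :=
  ∃ r : T ⟶ (R : C), r ≫ R.fst = x ∧ r ≫ R.snd = y

lemma Mem.comp_left {X Y T T' : C} {R : Relation X Y} {x : T ⟶ X} {y : T ⟶ Y}
    (h : R.Mem x y) (e : T' ⟶ T) : R.Mem (e ≫ x) (e ≫ y) := by
  obtain ⟨r, rfl, rfl⟩ := h
  exact ⟨e ≫ r, by simp, by simp⟩

lemma le_of_forall_mem {X Y : C} {R S : Relation X Y}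
    (h : ∀ ⦃T : C⦄ (x : T ⟶ X) (y : T ⟶ Y), R.Mem x y → S.Mem x y) : R ≤ S := by
  obtain ⟨r, h₁, h₂⟩ := h R.fst R.snd ⟨𝟙 _, by simp, by simp⟩
  exact Subobject.le_of_comm r (by ext <;> simpa)

/-- The chosen pullback of the adjacent legs covers the composite relation. -/
lemma exists_cover_comp {X Y Z : C} (R : Relation X Y) (S : Relation Y Z) :
    ∃ c : pullback R.snd S.fst ⟶ (R.comp S : C), IsRegularEpi c ∧
      c ≫ (R.comp S).fst = pullback.fst R.snd S.fst ≫ R.fst ∧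
      c ≫ (R.comp S).snd = pullback.snd R.snd S.fst ≫ S.snd := by
  let φ := prod.lift (pullback.fst R.snd S.fst ≫ R.fst) (pullback.snd R.snd S.fst ≫ S.snd)
  have : StrongEpi (factorThruImageSubobject φ) := strongEpi_comp _ _
  have hφ : IsRegularEpi (factorThruImageSubobject φ) := inferInstance
  have fac : factorThruImageSubobject φ ≫ (imageSubobject φ).arrow = φ :=
    imageSubobject_arrow_comp φ
  refine ⟨factorThruImageSubobject φ, hφ, ?_, ?_⟩
  · exact (Category.assoc _ _ _).symm.trans ((fac =≫ prod.fst).trans (prod.lift_fst _ _))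
  · exact (Category.assoc _ _ _).symm.trans ((fac =≫ prod.snd).trans (prod.lift_snd _ _))

/-- Two elements are related by a composite if and only if, locally, there is an element between
them. -/
lemma mem_comp_iff {X Y Z T : C} {R : Relation X Y} {S : Relation Y Z} {x : T ⟶ X} {z : T ⟶ Z} :
    (R.comp S).Mem x z ↔ ∃ (T' : C) (e : T' ⟶ T) (y : T' ⟶ Y), IsRegularEpi e ∧
      R.Mem (e ≫ x) y ∧ S.Mem y (e ≫ z) := by
  obtain ⟨c, hc, hc₁, hc₂⟩ := exists_cover_comp R S
  constructor
  · rintro ⟨t, rfl, rfl⟩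
    obtain ⟨T', e, w, he, hw⟩ := exists_cover_lift c t
    refine ⟨T', e, w ≫ pullback.fst _ _ ≫ R.snd, he, ⟨w ≫ pullback.fst _ _, ?_, ?_⟩,
      ⟨w ≫ pullback.snd _ _, ?_, ?_⟩⟩
    · rw [Category.assoc, ← hc₁, reassoc_of% hw]
    · rw [Category.assoc]
    · rw [Category.assoc, pullback.condition]
    · rw [Category.assoc, ← hc₂, reassoc_of% hw]
  · rintro ⟨T', e, y, he, ⟨r, hr, rfl⟩, ⟨s, hs, hs'⟩⟩
    let w : T' ⟶ pullback R.snd S.fst := pullback.lift r s hs.symm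
    -- The regular epimorphism `e` is orthogonal to the monomorphism representing the composite.
    have sq : CommSq (w ≫ c) e (R.comp S).arrow (prod.lift x z) := by
      refine ⟨prod.hom_ext ?_ ?_⟩
      · simp only [Category.assoc, hc₁, w, pullback.lift_fst_assoc, hr, prod.lift_fst]
      · simp only [Category.assoc, hc₂, w, pullback.lift_snd_assoc, hs', prod.lift_snd]
    refine ⟨sq.lift, ?_, ?_⟩
    · rw [sq.fac_right_assoc, prod.lift_fst]
    · rw [sq.fac_right_assoc, prod.lift_snd]

lemma mem_comp_comp_iff {X T : C} {R S : Relation X X} {x y : T ⟶ X} :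
    ((R.comp S).comp R).Mem x y ↔ ∃ (T' : C) (e : T' ⟶ T) (a b : T' ⟶ X), IsRegularEpi e ∧
      R.Mem (e ≫ x) a ∧ S.Mem a b ∧ R.Mem b (e ≫ y) := by
  constructor
  · intro h
    obtain ⟨T₁, e₁, b, he₁, h₁, h₂⟩ := mem_comp_iff.1 h
    obtain ⟨T₂, e₂, a, he₂, h₃, h₄⟩ := mem_comp_iff.1 h₁
    refine ⟨T₂, e₂ ≫ e₁, a, e₂ ≫ b, isRegularEpi_comp _ _, ?_, h₄, ?_⟩
    · simpa using h₃
    · simpa using h₂.comp_left e₂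
  · rintro ⟨T', e, a, b, he, h₁, h₂, h₃⟩
    refine mem_comp_iff.2 ⟨T', e, b, he, mem_comp_iff.2 ⟨T', 𝟙 _, a, inferInstance, ?_, ?_⟩, h₃⟩
    · simpa using h₁
    · simpa using h₂

section Equivalence

variable {X T : C} {R : Relation X X}

lemma IsEquivalence.refl (h : R.IsEquivalence) (x : T ⟶ X) : R.Mem x x := by
  obtain ⟨⟨h⟩⟩ := h
  exact ⟨x ≫ h.r, by rw [Category.assoc, h.reflexivity₁, Category.comp_id],
    by rw [Category.assoc, h.reflexivity₂, Category.comp_id]⟩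

lemma IsEquivalence.symm (h : R.IsEquivalence) {x y : T ⟶ X} (hxy : R.Mem x y) :
    R.Mem y x := by
  obtain ⟨⟨h⟩⟩ := h
  obtain ⟨r, rfl, rfl⟩ := hxy
  exact ⟨r ≫ h.s, by rw [Category.assoc, h.symmetry₁],
    by rw [Category.assoc, h.symmetry₂]⟩

lemma IsEquivalence.trans (h : R.IsEquivalence) {x y z : T ⟶ X} (hxy : R.Mem x y)
    (hyz : R.Mem y z) : R.Mem x z := by
  obtain ⟨⟨h⟩⟩ := h
  obtain ⟨r, rfl, rfl⟩ := hxy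
  obtain ⟨s, hs, rfl⟩ := hyz
  obtain ⟨l, hl₁, hl₂⟩ := PullbackCone.IsLimit.lift' h.isLimit r s hs.symm
  exact ⟨l ≫ h.t, by rw [Category.assoc, h.transitivity₁, reassoc_of% hl₁],
    by rw [Category.assoc, h.transitivity₂, reassoc_of% hl₂]⟩

lemma mem_iff_of_isKernelPair {Y : C} {f : X ⟶ Y} (h : IsKernelPair f R.fst R.snd)
    {x y : T ⟶ X} : R.Mem x y ↔ x ≫ f = y ≫ f := by
  constructor
  · intro hxy
    obtain ⟨r, rfl, rfl⟩ := hxy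
    simpa using r ≫= h.w
  · intro hxy
    exact ⟨h.lift x y hxy, h.lift_fst _ _ _, h.lift_snd _ _ _⟩

lemma IsEffective.isEquivalence (h : R.IsEffective) : R.IsEquivalence := by
  obtain ⟨Y, f, h⟩ := h
  exact (IsKernelPair.equivalenceRelation f _ _
    (IsPullback.of_hasPullback R.snd R.fst).isLimit h).isEquivalenceRelation

/-- The kernel pair of `f`, as the relation on `X` equalizing `f` on the two components. -/
noncomputable def ker {Y : C} (f : X ⟶ Y) : Relation X X :=
  equalizerSubobject (prod.fst ≫ f) (prod.snd ≫ f)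

lemma isKernelPair_ker {Y : C} (f : X ⟶ Y) : IsKernelPair f (ker f).fst (ker f).snd := by
  have w : (ker f).fst ≫ f = (ker f).snd ≫ f :=
    (Category.assoc _ _ _).trans
      ((equalizerSubobject_arrow_comp (prod.fst ≫ f) (prod.snd ≫ f)).trans
        (Category.assoc _ _ _).symm)
  have lift : ∀ ⦃T : C⦄ (x y : T ⟶ X), x ≫ f = y ≫ f → (ker f).Mem x y := by
    intro T x y h
    have hf : (ker f).Factors (prod.lift x y) :=
      (equalizerSubobject_factors_iff _ _ _).2 (by simpa using h)
    exact ⟨(ker f).factorThru _ hf, by simp, by simp⟩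
  choose l hl₁ hl₂ using lift
  refine ⟨⟨w⟩, ⟨PullbackCone.IsLimit.mk w (fun s => l s.fst s.snd s.condition)
    (fun s => hl₁ _ _ _) (fun s => hl₂ _ _ _) ?_⟩⟩
  intro s m h₁ h₂
  rw [← cancel_mono (ker f).arrow]
  refine prod.hom_ext ?_ ?_
  · simpa only [Category.assoc] using h₁.trans (hl₁ _ _ s.condition).symm
  · simpa only [Category.assoc] using h₂.trans (hl₂ _ _ s.condition).symm

end Equivalence

end Relation

/-! ### Three-permutability of kernel pairs and of equivalence relations -/

variable (C) in
/-- Elementwise three-permutability of kernel pairs: `x₁` and `x₄` being linked through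
`Eq(f) Eq(g) Eq(f)` by given elements `x₂` and `x₃`, they are locally linked through
`Eq(g) Eq(f) Eq(g)`. -/
def KernelPairsThreePermute : Prop :=
  ∀ ⦃X A B T : C⦄ (f : X ⟶ A) (g : X ⟶ B) (x₁ x₂ x₃ x₄ : T ⟶ X),
    x₁ ≫ f = x₂ ≫ f → x₂ ≫ g = x₃ ≫ g → x₃ ≫ f = x₄ ≫ f →
    ∃ (T' : C) (e : T' ⟶ T) (q q' : T' ⟶ X), IsRegularEpi e ∧
      e ≫ x₁ ≫ g = q ≫ g ∧ q ≫ f = q' ≫ f ∧ q' ≫ g = e ≫ x₄ ≫ g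

lemma IsGoursat.isEffectivelyGoursat (h : IsGoursat C) : IsEffectivelyGoursat C :=
  fun X R S hR hS => h X R S hR.isEquivalence hS.isEquivalence

lemma IsEffectivelyGoursat.kernelPairsThreePermute (h : IsEffectivelyGoursat C) :
    KernelPairsThreePermute C := by
  intro X A B T f g x₁ x₂ x₃ x₄ h₁ h₂ h₃
  have hf := Relation.isKernelPair_ker f
  have hg := Relation.isKernelPair_ker g
  have mem : (((Relation.ker f).comp (Relation.ker g)).comp (Relation.ker f)).Mem x₁ x₄ :=
    Relation.mem_comp_comp_iff.2 ⟨T, 𝟙 T, x₂, x₃, inferInstance,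
      by rwa [Category.id_comp, Relation.mem_iff_of_isKernelPair hf],
      (Relation.mem_iff_of_isKernelPair hg).2 h₂,
      by rwa [Category.id_comp, Relation.mem_iff_of_isKernelPair hf]⟩
  rw [h X _ _ ⟨A, f, hf⟩ ⟨B, g, hg⟩] at mem
  obtain ⟨T', e, q, q', he, h₁, h₂, h₃⟩ := Relation.mem_comp_comp_iff.1 mem
  rw [Relation.mem_iff_of_isKernelPair hg, Category.assoc] at h₁ h₃
  exact ⟨T', e, q, q', he, h₁, (Relation.mem_iff_of_isKernelPair hf).1 h₂, h₃⟩

/-- The passage from effective to arbitrary equivalence relations: the kernel pairs used are those of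
the two outer projections from the object of triples `x R y S z`. -/
lemma KernelPairsThreePermute.comp_comp_le (H : KernelPairsThreePermute C) {X : C}
    {R S : Relation X X} (hR : R.IsEquivalence) (hS : S.IsEquivalence) :
    (S.comp R).comp S ≤ (R.comp S).comp R := by
  refine Relation.le_of_forall_mem fun T u w h => ?_
  obtain ⟨T₁, e₁, a, b, he₁, hua, hab, hbw⟩ := Relation.mem_comp_comp_iff.1 h
  let P := pullback R.snd S.fst
  let first : P ⟶ X := pullback.fst R.snd S.fst ≫ R.fst
  let last : P ⟶ X := pullback.snd R.snd S.fst ≫ S.snd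
  have key : ∀ ⦃T : C⦄ (x y z : T ⟶ X), R.Mem x y → S.Mem y z →
      ∃ t : T ⟶ P, t ≫ first = x ∧ t ≫ last = z := by
    intro T x y z hxy hyz
    obtain ⟨r, hr, hr'⟩ := hxy
    obtain ⟨s, hs, hs'⟩ := hyz
    exact ⟨pullback.lift r s (hr'.trans hs.symm), by simpa [first] using hr,
      by simpa [last] using hs'⟩
  have key' : ∀ ⦃T : C⦄ (t : T ⟶ P), ∃ y : T ⟶ X, R.Mem (t ≫ first) y ∧ S.Mem y (t ≫ last) := by
    intro T t
    refine ⟨t ≫ pullback.fst _ _ ≫ R.snd, ⟨t ≫ pullback.fst _ _, ?_, ?_⟩,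
      ⟨t ≫ pullback.snd _ _, ?_, ?_⟩⟩
    · simp [first]
    · simp
    · simp [pullback.condition]
    · simp [last]
  -- For `u S a R b S w`, the triples are `(u, u, a)`, `(b, a, a)`, `(b, b, w)` and `(w, w, w)`, with
  -- consecutive ones sharing alternately the last and the first component.
  obtain ⟨t₁, h₁, h₁'⟩ := key _ _ _ (hR.refl _) hua
  obtain ⟨t₂, h₂, h₂'⟩ := key _ _ _ (hR.symm hab) (hS.refl _)
  obtain ⟨t₃, h₃, h₃'⟩ := key _ _ _ (hR.refl _) hbw
  obtain ⟨t₄, h₄, h₄'⟩ := key _ _ _ (hR.refl (e₁ ≫ w)) (hS.refl _)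
  obtain ⟨T₂, e₂, q, q', he₂, h₅, h₆, h₇⟩ := H last first t₁ t₂ t₃ t₄ (h₁'.trans h₂'.symm)
    (h₂.trans h₃.symm) (h₃'.trans h₄'.symm)
  obtain ⟨y, hy, hy'⟩ := key' q
  obtain ⟨y', hz, hz'⟩ := key' q'
  refine Relation.mem_comp_comp_iff.2 ⟨T₂, e₂ ≫ e₁, y, y', isRegularEpi_comp _ _, ?_, ?_, ?_⟩
  · rwa [← h₅, h₁, ← Category.assoc] at hy
  · exact hS.trans hy' (hS.symm (h₆ ▸ hz'))
  · rw [h₇, h₄, ← Category.assoc] at hz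
    exact hR.symm hz

lemma KernelPairsThreePermute.isGoursat (H : KernelPairsThreePermute C) : IsGoursat C :=
  fun _ _ _ hR hS => le_antisymm (H.comp_comp_le hS hR) (H.comp_comp_le hR hS)

/-! ### From three-permutability to cubes -/

lemma KernelPairsThreePermute.comparisonIsRegularEpi (H : KernelPairsThreePermute C) :
    ComparisonIsRegularEpi C := by
  intro K P Q πX πZ πU πV c left right hU hV
  have := K.regularEpi_α
  have := K.regularEpi_γ
  refine isRegularEpi_of_exists_cover_lift c fun T p => ?_
  obtain ⟨T₁, e₁, x, he₁, hx⟩ := exists_cover_lift K.α (p ≫ πU)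
  obtain ⟨T₂, e₂, z, he₂, hz⟩ := exists_cover_lift K.γ (e₁ ≫ p ≫ πV)
  obtain ⟨y₁, hy₁⟩ : ∃ y₁, e₂ ≫ x ≫ K.f = y₁ := ⟨_, rfl⟩
  obtain ⟨y₂, hy₂⟩ : ∃ y₂, z ≫ K.l = y₂ := ⟨_, rfl⟩
  have hβ : y₁ ≫ K.β = y₂ ≫ K.β := by
    simp only [← hy₁, ← hy₂, Category.assoc, K.f_β, K.l_β, reassoc_of% hx, reassoc_of% hz, right.w]
  have hi : y₁ ≫ K.i ≫ K.α = y₂ ≫ K.i ≫ K.α := by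
    rw [K.i_α, reassoc_of% hβ]
  have hk : y₁ ≫ K.k ≫ K.γ = y₂ ≫ K.k ≫ K.γ := by
    rw [K.k_γ, reassoc_of% hβ]
  -- The four points are `(x, kfx)`, `(iy₁, ky₁)`, `(iy₂, ky₂)` and `(ilz, z)`, where `y₁ = fx` and
  -- `y₂ = lz`. The middle two have the same image under `c` because `βy₁ = βy₂`.
  obtain ⟨T₃, e₃, q, q', he₃, h₁, h₂, h₃⟩ := H (πX ≫ K.f) c
    (e₂ ≫ x ≫ K.secX left)
    (left.lift (y₁ ≫ K.i) (y₁ ≫ K.k) (by simp [K.i_f, K.k_l]))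
    (left.lift (y₂ ≫ K.i) (y₂ ≫ K.k) (by simp [K.i_f, K.k_l]))
    (z ≫ K.secZ left)
    (by simp [reassoc_of% K.secX_fst left, K.i_f, hy₁])
    (right.hom_ext (by simpa [hU] using hi) (by simpa [hV] using hk))
    (by simp [reassoc_of% K.secZ_fst left, K.i_f, hy₂])
  refine ⟨T₃, e₃ ≫ e₂ ≫ e₁, left.lift (q ≫ πX) (q' ≫ πZ) (by simpa [left.w] using h₂),
    ?_, right.hom_ext ?_ ?_⟩
  · have := isRegularEpi_comp e₂ e₁
    exact isRegularEpi_comp _ _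
  · have := h₁ =≫ πU
    simp only [Category.assoc, hU, reassoc_of% K.secX_fst left, hx] at this
    simp [hU, this]
  · have := h₃ =≫ πV
    simp only [Category.assoc, hV, reassoc_of% K.secZ_snd left, hz] at this
    simp [hV, this]

/-- The shifting lemma for the kernel pairs of `r`, `s` and `d`: if `Eq(r) ⊓ Eq(s) ≤ Eq(d)`, then in a
rectangle `x, y, y', x'` with sides in `Eq(r)` and `Eq(s)`, the relation `y Eq(d) y'` shifts to the
opposite side `x Eq(d) x'`. It holds because `Eq(r)` three-permutes with `Eq(d) ⊓ Eq(s)`, the kernel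
pair of `⟨d, s⟩`, so that `x` and `x'` are also linked through two elements that are related both by
`Eq(r)` and by `Eq(s)`. -/
lemma KernelPairsThreePermute.shifting (H : KernelPairsThreePermute C) {P A B D : C}
    (r : P ⟶ A) (s : P ⟶ B) (d : P ⟶ D)
    (hrs : ∀ ⦃T : C⦄ (u v : T ⟶ P), u ≫ r = v ≫ r → u ≫ s = v ≫ s → u ≫ d = v ≫ d)
    {T : C} {x y y' x' : T ⟶ P} (hxy : x ≫ r = y ≫ r) (hy : y ≫ d = y' ≫ d)
    (hy' : y ≫ s = y' ≫ s) (hyx' : y' ≫ r = x' ≫ r) (hx : x ≫ s = x' ≫ s) :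
    x ≫ d = x' ≫ d := by
  obtain ⟨T', e, q, q', he, h₁, h₂, h₃⟩ := H r (prod.lift d s) x y y' x' hxy
    (by ext <;> simpa) hyx'
  have h₁d := h₁ =≫ prod.fst
  have h₁s := h₁ =≫ prod.snd
  have h₃d := h₃ =≫ prod.fst
  have h₃s := h₃ =≫ prod.snd
  simp only [Category.assoc, prod.lift_fst, prod.lift_snd] at h₁d h₁s h₃d h₃s
  rw [← cancel_epi e, h₁d, ← h₃d]
  exact hrs q q' h₂ (by rw [← h₁s, h₃s, hx])

lemma KernelPairsThreePermute.rightFaceIsPullback (H : KernelPairsThreePermute C) :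
    RightFaceIsPullback C := by
  intro K D
  have := D.regularEpi_δ
  have right := IsPullback.of_hasPullback K.g K.h
  let n : D.A ⟶ pullback K.g K.h := pullback.lift D.a D.b D.a_g
  have hn : IsRegularEpi n := by
    have : IsRegularEpi (D.δ ≫ n) :=
      H.comparisonIsRegularEpi K D.πX D.πZ _ _ _ D.left right (by simp [n, D.δ_a])
        (by simp [n, D.δ_b])
    exact isRegularEpi_of_isRegularEpi_comp D.δ n
  have secX : ∀ ⦃T : C⦄ (x x' : T ⟶ K.X), x ≫ K.α = x' ≫ K.α →
      x ≫ K.secX D.left ≫ D.δ = x' ≫ K.secX D.left ≫ D.δ := by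
    intro T x x' h
    rw [D.sec_δ_s, reassoc_of% h]
  have secZ : ∀ ⦃T : C⦄ (z z' : T ⟶ K.Z), z ≫ K.γ = z' ≫ K.γ →
      z ≫ K.secZ D.left ≫ D.δ = z' ≫ K.secZ D.left ≫ D.δ := by
    intro T z z' h
    rw [D.sec_δ_t, reassoc_of% h]
  -- First with the component in `X` fixed: shift from `(ilz, z)` to `(x, z)` along `Eq(πZ)`, using that
  -- `πX` and `πZ` are jointly monic.
  have step : ∀ ⦃T : C⦄ (u v : T ⟶ D.P), u ≫ D.πX = v ≫ D.πX →
      u ≫ D.δ ≫ n = v ≫ D.δ ≫ n → u ≫ D.δ = v ≫ D.δ := by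
    intro T u v hX hn
    have hY : u ≫ D.πZ ≫ K.l = v ≫ D.πZ ≫ K.l := by
      rw [← D.left.w, reassoc_of% hX]
    refine H.shifting D.πZ D.πX D.δ (fun T u v h₁ h₂ => by rw [D.left.hom_ext h₂ h₁])
      (y := u ≫ D.πZ ≫ K.secZ D.left) (y' := v ≫ D.πZ ≫ K.secZ D.left) ?_ ?_ ?_ ?_ hX
    · simp [K.secZ_snd D.left]
    · simpa using secZ (u ≫ D.πZ) (v ≫ D.πZ)
        (by simpa [n, D.δ_b] using hn =≫ pullback.snd K.g K.h)
    · simp only [Category.assoc, K.secZ_fst D.left, reassoc_of% hY]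
    · simp [K.secZ_snd D.left]
  -- Then in general: shift from `(x, kfx)` to `(x, z)` along `Eq(πX)`; the hypothesis of the shifting
  -- lemma is the preceding special case.
  have hδ : ∀ ⦃T : C⦄ (u v : T ⟶ D.P), u ≫ D.δ ≫ n = v ≫ D.δ ≫ n → u ≫ D.δ = v ≫ D.δ := by
    intro T u v h
    have hX : (u ≫ D.πX ≫ K.secX D.left) ≫ D.δ = (v ≫ D.πX ≫ K.secX D.left) ≫ D.δ := by
      simpa using secX (u ≫ D.πX) (v ≫ D.πX)
        (by simpa [n, D.δ_a] using h =≫ pullback.fst K.g K.h)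
    refine H.shifting D.πX (D.δ ≫ n) D.δ step
      (y := u ≫ D.πX ≫ K.secX D.left) (y' := v ≫ D.πX ≫ K.secX D.left) ?_ hX ?_ ?_ h
    · simp [K.secX_fst D.left]
    · simpa using hX =≫ n
    · simp [K.secX_fst D.left]
  have : Mono n := by
    refine ⟨fun {T} u v h => ?_⟩
    obtain ⟨T₁, e₁, p, he₁, hp⟩ := exists_cover_lift D.δ u
    obtain ⟨T₂, e₂, p', he₂, hp'⟩ := exists_cover_lift D.δ (e₁ ≫ v)
    have := hδ (e₂ ≫ p) p' (by simp [reassoc_of% hp, reassoc_of% hp', h])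
    rw [Category.assoc, hp, hp'] at this
    rwa [cancel_epi, cancel_epi] at this
  have : IsIso n := isIso_of_mono_of_strongEpi n
  exact .of_iso right (asIso n).symm (Iso.refl _) (Iso.refl _) (Iso.refl _)
    (by simp [n]) (by simp [n]) (by simp) (by simp)

/-! ### From cubes to three-permutability -/

/-- The regular image of the comparison morphism is the right face of a cube; its splittings come from
orthogonality of the regular epimorphisms `α` and `γ` to the monomorphism part. -/
lemma RightFaceIsPullback.comparisonIsRegularEpi (H : RightFaceIsPullback C) :
    ComparisonIsRegularEpi C := by
  intro K P Q πX πZ πU πV c left right hU hV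
  have := K.regularEpi_α
  have := K.regularEpi_γ
  let F := Regular.strongEpiMonoFactorisation c
  have fac : F.e ≫ F.m = c := F.fac
  have sqX : CommSq (K.secX left ≫ F.e) K.α F.m
      (right.lift (𝟙 K.U) (K.g ≫ K.m) (by simp [K.m_h])) := by
    refine ⟨right.hom_ext ?_ ?_⟩
    · simp [fac, hU, reassoc_of% K.secX_fst left]
    · simp [fac, hV, reassoc_of% K.secX_snd left, K.k_γ, reassoc_of% K.f_β]
  have sqZ : CommSq (K.secZ left ≫ F.e) K.γ F.m
      (right.lift (K.h ≫ K.j) (𝟙 K.V) (by simp [K.j_g])) := by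
    refine ⟨right.hom_ext ?_ ?_⟩
    · simp [fac, hU, reassoc_of% K.secZ_fst left, K.i_α, reassoc_of% K.l_β]
    · simp [fac, hV, reassoc_of% K.secZ_snd left]
  let D : GeneralCube K :=
    { P := P
      A := F.I
      πX := πX
      πZ := πZ
      left := left
      a := F.m ≫ πU
      s := sqX.lift
      b := F.m ≫ πV
      t := sqZ.lift
      s_a := by rw [sqX.fac_right_assoc]; simp
      t_b := by rw [sqZ.fac_right_assoc]; simp
      a_g := by simp [right.w]
      j_s := by
        rw [← cancel_mono F.m]
        refine right.hom_ext ?_ ?_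
        · simp [reassoc_of% K.m_h]
        · simp [reassoc_of% K.j_g]
      δ := F.e
      δ_a := by rw [reassoc_of% fac, hU]
      δ_b := by rw [reassoc_of% fac, hV]
      sec_δ_s := sqX.fac_left.symm
      sec_δ_t := sqZ.fac_left.symm
      regularEpi_δ := inferInstanceAs (IsRegularEpi (Regular.strongEpiMonoFactorisation c).e) }
  have : IsIso F.m := by
    refine ⟨(H K D).lift πU πV right.w, ?_, ?_⟩
    · exact (H K D).hom_ext (by simp [D]) (by simp [D])
    · exact right.hom_ext
        (by simpa only [D, Category.assoc, Category.id_comp] using (H K D).lift_fst πU πV right.w)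
        (by simpa only [D, Category.assoc, Category.id_comp] using (H K D).lift_snd πU πV right.w)
  rw [← fac]
  have : IsRegularEpi F.e := D.regularEpi_δ
  exact isRegularEpi_comp _ _

/-- The cube used has as front and bottom faces the point `Eq(f) ⟶ X` split by the diagonal, lying
over the direct image of `Eq(f)` along the regular epimorphism part `φ` of `g`. -/
lemma ComparisonIsRegularEpi.kernelPairsThreePermute (H : ComparisonIsRegularEpi C) :
    KernelPairsThreePermute C := by
  intro X A B T f g x₁ x₂ x₃ x₄ h₁ h₂ h₃
  let F := Regular.strongEpiMonoFactorisation g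
  let φ : X ⟶ F.I := F.e
  have hφ : IsRegularEpi φ :=
    inferInstanceAs (IsRegularEpi (Regular.strongEpiMonoFactorisation g).e)
  have hg : φ ≫ F.m = g := F.fac
  let r₁ := pullback.fst f f
  let r₂ := pullback.snd f f
  let G := Regular.strongEpiMonoFactorisation (prod.lift (r₁ ≫ φ) (r₂ ≫ φ))
  let ρ : pullback f f ⟶ G.I := G.e
  have hρ : IsRegularEpi ρ :=
    inferInstanceAs (IsRegularEpi (Regular.strongEpiMonoFactorisation _).e)
  have fac : ρ ≫ G.m = prod.lift (r₁ ≫ φ) (r₂ ≫ φ) := G.fac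
  let i : X ⟶ pullback f f := pullback.lift (𝟙 X) (𝟙 X) rfl
  have sq : CommSq (i ≫ ρ) φ G.m (prod.lift (𝟙 F.I) (𝟙 F.I)) := by
    refine ⟨?_⟩
    rw [Category.assoc, fac]
    ext <;> simp [i, r₁, r₂]
  let K : CubeBase C :=
    { f := r₁
      i := i
      l := r₁
      k := i
      g := G.m ≫ prod.fst
      j := sq.lift
      h := G.m ≫ prod.fst
      m := sq.lift
      α := ρ
      β := φ
      γ := ρ
      i_f := by simp [i, r₁]
      k_l := by simp [i, r₁]
      j_g := by rw [sq.fac_right_assoc]; simp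
      m_h := by rw [sq.fac_right_assoc]; simp
      f_β := by rw [reassoc_of% fac]; simp
      i_α := sq.fac_left.symm
      l_β := by rw [reassoc_of% fac]; simp
      k_γ := sq.fac_left.symm
      regularEpi_α := hρ
      regularEpi_β := hφ
      regularEpi_γ := hρ }
  have ρ₁ : ρ ≫ G.m ≫ prod.fst = r₁ ≫ φ := by rw [reassoc_of% fac]; simp
  have ρ₂ : ρ ≫ G.m ≫ prod.snd = r₂ ≫ φ := by rw [reassoc_of% fac]; simp
  let c : pullback r₁ r₁ ⟶ pullback (G.m ≫ prod.fst) (G.m ≫ prod.fst) :=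
    pullback.lift (pullback.fst r₁ r₁ ≫ ρ) (pullback.snd r₁ r₁ ≫ ρ)
      (by simp only [Category.assoc, ρ₁, pullback.condition_assoc])
  have hc : IsRegularEpi c := H K (pullback.fst r₁ r₁) (pullback.snd r₁ r₁)
    (pullback.fst (G.m ≫ prod.fst) (G.m ≫ prod.fst)) (pullback.snd _ _) c
    (IsPullback.of_hasPullback _ _) (IsPullback.of_hasPullback _ _)
    (pullback.lift_fst _ _ _) (pullback.lift_snd _ _ _)
  have hx : x₂ ≫ φ = x₃ ≫ φ := by
    rw [← cancel_mono F.m]; simpa [hg] using h₂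
  -- The pairs `(φx₂, φx₁)` and `(φx₃, φx₄)` have the same first component, so they lift to pairs in
  -- `Eq(f)` that have the same first component; the second components are the elements sought.
  let z₁ : T ⟶ pullback f f := pullback.lift x₂ x₁ h₁.symm
  let z₂ : T ⟶ pullback f f := pullback.lift x₃ x₄ h₃
  obtain ⟨T', e, p, he, hp⟩ := exists_cover_lift c
    (pullback.lift (f := G.m ≫ prod.fst) (g := G.m ≫ prod.fst) (z₁ ≫ ρ) (z₂ ≫ ρ)
      (by simpa [ρ₁, z₁, z₂, r₁] using hx))
  have hp₁ := hp =≫ (pullback.fst _ _ ≫ G.m ≫ prod.snd)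
  have hp₂ := hp =≫ (pullback.snd _ _ ≫ G.m ≫ prod.snd)
  simp only [Category.assoc, c, pullback.lift_fst_assoc, pullback.lift_snd_assoc, ρ₂] at hp₁ hp₂
  refine ⟨T', e, p ≫ pullback.fst r₁ r₁ ≫ r₂, p ≫ pullback.snd r₁ r₁ ≫ r₂, he, ?_, ?_, ?_⟩
  · simpa [hg, z₁, r₂] using (hp₁ =≫ F.m).symm
  · have hf : r₂ ≫ f = r₁ ≫ f := pullback.condition.symm
    simp only [Category.assoc, hf, pullback.condition_assoc]
  · simpa [hg, z₂, r₂] using hp₂ =≫ F.m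

end

end GoursatCube

theorem theorem1p3 (C : Type u) [Category.{v} C] [Regular C] :
    List.TFAE [GoursatCube.IsGoursat C, GoursatCube.IsEffectivelyGoursat C,
      GoursatCube.ComparisonIsRegularEpi C, GoursatCube.RightFaceIsPullback C] := by
  tfae_have 1 → 2 := fun h => h.isEffectivelyGoursat
  tfae_have 2 → 1 := fun h => h.kernelPairsThreePermute.isGoursat
  tfae_have 2 → 4 := fun h => h.kernelPairsThreePermute.rightFaceIsPullback
  tfae_have 4 → 3 := fun h => h.comparisonIsRegularEpi
  tfae_have 3 → 1 := fun h => h.kernelPairsThreePermute.isGoursat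
  tfae_finish
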